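/- Write points of Minkowski spacetime $\mathbb{R}^4$ as $x = (t,\vec{x})$ with $t \in \mathbb{R}$, $\vec{x} \in \mathbb{R}^3$, and let $x^2 = -t^2 + |\vec{x}|^2$. Let $f \in C_0^\infty(\mathbb{R}^4)$ be a smooth, compactly supported, complex-valued (in particular, possibly real-valued) function with vanishing mean, $\int f(x) \, \mathrm{d}^4 x = 0$. For $\vec{p} \in \mathbb{R}^3 \setminus \{0\}$ put $$G_f(\vec{p}) = \iint f(x) f(x') \, \frac{1}{4 |\vec{p}|^3} \, \mathrm{e}^{-\mathrm{i} |\vec{p}| (t-t')} \bigl[ 1 + \mathrm{i} |\vec{p}| (t-t') \bigr] \, \mathrm{e}^{\mathrm{i} \vec{p} \cdot (\vec{x}-\vec{x}')} \, \mathrm{d}^4 x \, \mathrm{d}^4 x' .$$ Then $G_f$ is Lebesgue integrable on $\mathbb{R}^3$, the function $(x,x') \mapsto f(x) f(x') \ln|(x-x')^2|$ is Lebesgue integrable on $\mathbb{R}^4 \times \mathbb{R}^4$, and $$\int_{\mathbb{R}^3} G_f(\vec{p}) \, \frac{\mathrm{d}^3 \vec{p}}{(2\pi)^3} = - \frac{1}{16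 \pi^2} \iint f(x) f(x') \ln\bigl| (x-x')^2 \bigr| \, \mathrm{d}^4 x \, \mathrm{d}^4 x' .$$ The left-hand side is the pairing of $f \otimes f$ with the inverse spatial Fourier transform, in the sense of distributions, of the kernel $\frac{1}{4|\vec{p}|^3} \mathrm{e}^{-\mathrm{i}|\vec{p}|(t-t')} [1 + \mathrm{i}|\vec{p}|(t-t')]$. -/

import Mathlib

/-- Minkowski spacetime `ℝ⁴` with Cartesian coordinates `x = (t, 𝐱)`: the time `x.1 = t` and the
Euclidean space vector `x.2 = 𝐱 ∈ ℝ³`. Its `volume` is the Lebesgue measure `dt d³𝐱`. -/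
abbrev Spacetime : Type := ℝ × EuclideanSpace ℝ (Fin 3)

/-- The Minkowski square `x² = -t² + |𝐱|²`. -/
noncomputable def minkowskiSq (x : Spacetime) : ℝ := -x.1 ^ 2 + ‖x.2‖ ^ 2

/-- The momentum-space kernel
`F(t, t', p) = (1 / (4 |p|³)) exp(-i |p| (t - t')) (1 + i |p| (t - t'))`. -/
noncomputable def momentumKernel (t t' : ℝ) (p : EuclideanSpace ℝ (Fin 3)) : ℂ :=
  1 / (4 * (‖p‖ : ℂ) ^ 3) * Complex.exp (-Complex.I * ‖p‖ * (t - t')) *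
    (1 + Complex.I * ‖p‖ * (t - t'))

/-- The kernel `F(t, t', p) exp(i p · (𝐱 - 𝐱'))`, at fixed momentum `p`, tested against `f ⊗ f`.
The inverse spatial Fourier transform of `F` is a distribution; its pairing with `f ⊗ f` is
the integral of `smearedKernel f p` against `d³p / (2π)³`. -/
noncomputable def smearedKernel (f : Spacetime → ℂ) (p : EuclideanSpace ℝ (Fin 3)) : ℂ :=
  ∫ x : Spacetime, ∫ x' : Spacetime,
    f x * f x' *
      (momentumKernel x.1 x'.1 p * Complex.exp (Complex.I * (inner ℝ p (x.2 - x'.2) : ℝ)))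

open MeasureTheory Set Filter Topology

/-! Replace `i (t - t')` by `s = ε + i (t - t')` with `ε > 0`. The kernel is of order `‖p‖⁻³` at the
origin, which is not integrable, but since `∫ f = 0` the term `radialKernel 1 ‖p‖`, independent of
`x` and `x'`, may be subtracted at no cost. The difference is absolutely integrable in `p`, and
Fubini applies.

The inner integral is `integral_radialKernel_sub`. Rotate `𝐱 - 𝐱'`, of length `r`, onto the first
axis. On each plane `p 0 = k` the kernel is an exact derivative in polar coordinates and leaves
`(π/2) exp(-s|k|)/|k|`; the remaining integral over `k` is of Frullani type and gives `-(π/2) (log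
(s - i r) + log (s + i r))`. Exchanging `x` and `x'` conjugates this, so only the real part
survives, and as `ε → 0` the sum of logarithms has real part tending to `log |t-t'-r| + log |t-t'+r|
= log |(x-x')²|`.

Both sides pass to the limit by dominated convergence. In position space the logarithm is integrable
across the light cone (`integrable_tensor_mul_abs_log`). In momentum space the smearing factors into
on-shell Fourier integrals of `f` and `t f`: the vanishing mean controls `p = 0`, and one
integration by parts in time controls infinity (`exists_norm_regularizedSmearing_le`). -/

/-! ### Exponential estimates and a complex Frullani integral. -/

/-- Lipschitz estimate for the complex exponential on a left half-plane. -/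
lemma norm_cexp_sub_cexp_le {z w : ℂ} {m : ℝ} (hz : z.re ≤ m) (hw : w.re ≤ m) :
    ‖Complex.exp z - Complex.exp w‖ ≤ Real.exp m * ‖z - w‖ := by
  refine Convex.norm_image_sub_le_of_norm_deriv_le (𝕜 := ℂ) (s := {u : ℂ | u.re ≤ m})
    (fun x _ => Complex.differentiableAt_exp) (fun x hx => ?_) (convex_halfSpace_re_le m) hw hz
  rw [Complex.deriv_exp, Complex.norm_exp]
  exact Real.exp_le_exp.2 hx

/-- The Lipschitz estimate supplies a factor `k` that cancels the denominator. -/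
lemma norm_cexp_sub_cexp_div_le {a b : ℂ} {δ : ℝ} (ha : δ ≤ a.re) (hb : δ ≤ b.re)
    {k : ℝ} (hk : 0 < k) :
    ‖(Complex.exp (-(a * k)) - Complex.exp (-(b * k))) / k‖ ≤ ‖a - b‖ * Real.exp (-δ * k) := by
  have h := norm_cexp_sub_cexp_le (z := -(a * k)) (w := -(b * k)) (m := -δ * k)
    (by simp; nlinarith) (by simp; nlinarith)
  rw [norm_div, Complex.norm_real, Real.norm_of_nonneg hk.le, div_le_iff₀ hk]
  refine h.trans (le_of_eq ?_)
  rw [show -(a * (k : ℂ)) - -(b * k) = -((a - b) * k) by ring, norm_neg, norm_mul,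
    Complex.norm_real, Real.norm_of_nonneg hk.le]
  ring

lemma integrableOn_cexp_sub_cexp_div {a b : ℂ} (ha : 0 < a.re) (hb : 0 < b.re) :
    IntegrableOn (fun k : ℝ => (Complex.exp (-(a * k)) - Complex.exp (-(b * k))) / k) (Ioi 0) := by
  have hδ : 0 < min a.re b.re := lt_min ha hb
  refine Integrable.mono' ((integrableOn_exp_mul_Ioi (a := -(min a.re b.re)) (by linarith) 0).const_mul
    ‖a - b‖) (Measurable.aestronglyMeasurable (by fun_prop)) ?_
  filter_upwards [self_mem_ae_restrict measurableSet_Ioi] with k hk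
  exact norm_cexp_sub_cexp_div_le (min_le_left _ _) (min_le_right _ _) hk

/-- A complex Frullani integral. -/
lemma integral_cexp_sub_cexp_div {a : ℂ} (ha : 0 < a.re) :
    ∫ k in Ioi (0 : ℝ), (Complex.exp (-(a * k)) - Complex.exp (-(1 * k))) / k
      = -Complex.log a := by
  set δ := min a.re 1 with hδdef
  have hδ : 0 < δ := lt_min ha one_pos
  -- The whole segment from `1` to `a` stays in the half-plane `Re ≥ δ`, away from the branch cut.
  have hre : ∀ u : ℝ, u ∈ Icc (0 : ℝ) 1 → δ ≤ (1 + u * (a - 1)).re := by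
    intro u hu
    have h1 : δ ≤ a.re := min_le_left _ _
    have h2 : δ ≤ 1 := min_le_right _ _
    simp
    nlinarith [mul_nonneg hu.1 (sub_nonneg.2 h1), mul_nonneg (sub_nonneg.2 hu.2) (sub_nonneg.2 h2)]
  -- The quotient is an integral of exponentials along that segment; after Fubini the `k`-integral
  -- is elementary and leaves the logarithmic derivative.
  have key : ∀ k ∈ Ioi (0 : ℝ), (Complex.exp (-(a * k)) - Complex.exp (-(1 * k))) / k
      = ∫ u in (0 : ℝ)..1, -(a - 1) * Complex.exp (-((1 + u * (a - 1)) * k)) := by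
    intro k hk
    have hk0 : (k : ℂ) ≠ 0 := by exact_mod_cast (ne_of_gt hk)
    rw [intervalIntegral.integral_eq_sub_of_hasDerivAt
      (f := fun u : ℝ => Complex.exp (-((1 + u * (a - 1)) * k)) / k)]
    · simp; ring
    · intro u _
      have h := (((((Complex.ofRealCLM.hasDerivAt (x := u)).mul_const (a - 1)).const_add 1).mul_const
        (k : ℂ)).neg.cexp).div_const (k : ℂ)
      refine h.congr_deriv ?_
      simp only [Complex.ofRealCLM_apply, Complex.ofReal_one, Pi.neg_apply]
      field_simp
    · exact Continuous.intervalIntegrable (by fun_prop) _ _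
  rw [setIntegral_congr_fun measurableSet_Ioi key]
  simp_rw [intervalIntegral.integral_of_le zero_le_one]
  rw [integral_integral_swap]
  · have inner : ∀ u ∈ Ioc (0 : ℝ) 1,
        ∫ k in Ioi (0 : ℝ), -(a - 1) * Complex.exp (-((1 + u * (a - 1)) * k))
          = -((a - 1) / (1 + u * (a - 1))) := by
      intro u hu
      have h0 := hre u ⟨hu.1.le, hu.2⟩
      have hne : (1 + u * (a - 1)) ≠ 0 := by
        intro h; rw [h] at h0; simp at h0; linarith
      rw [integral_const_mul]
      have := integral_exp_mul_complex_Ioi (a := -(1 + u * (a - 1)))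
        (by rw [Complex.neg_re]; linarith) 0
      simp_rw [← neg_mul]
      rw [this]
      simp only [Complex.ofReal_zero, mul_zero, Complex.exp_zero, neg_div_neg_eq]
      ring
    rw [setIntegral_congr_fun measurableSet_Ioc inner, ← intervalIntegral.integral_of_le zero_le_one,
      intervalIntegral.integral_neg]
    congr 1
    rw [intervalIntegral.integral_eq_sub_of_hasDerivAt
      (f := fun u : ℝ => Complex.log (1 + u * (a - 1)))]
    · simp
    · intro u hu
      rw [uIcc_of_le zero_le_one] at hu
      have h0 := hre u hu
      have h := (((Complex.ofRealCLM.hasDerivAt (x := u)).mul_const (a - 1)).const_add 1)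
      have h' := h.clog_real (Or.inl (by simpa using lt_of_lt_of_le hδ h0))
      simpa using h'
    · refine ContinuousOn.intervalIntegrable ?_
      rw [uIcc_of_le zero_le_one]
      refine ContinuousOn.div (by fun_prop) (by fun_prop) ?_
      intro u hu h
      have h0 := hre u hu
      rw [h] at h0; simp at h0; linarith
  · have hdom : Integrable (fun z : ℝ × ℝ => (‖a - 1‖ * Real.exp (-δ * z.1)) * (1 : ℝ))
        ((volume.restrict (Ioi 0)).prod (volume.restrict (Ioc 0 1))) :=
      Integrable.mul_prod ((integrableOn_exp_mul_Ioi (a := -δ) (by linarith) 0).const_mul ‖a - 1‖)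
        (integrable_const (1 : ℝ))
    refine hdom.mono' (Continuous.aestronglyMeasurable (by fun_prop)) ?_
    rw [Measure.prod_restrict]
    filter_upwards [self_mem_ae_restrict (measurableSet_Ioi.prod measurableSet_Ioc)] with z hz
    have h0 := hre z.2 ⟨hz.2.1.le, hz.2.2⟩
    simp only [Function.uncurry, norm_mul, norm_neg, Complex.norm_exp, mul_one]
    gcongr
    have hz1 : (0 : ℝ) < z.1 := hz.1
    rw [Complex.neg_re, Complex.re_mul_ofReal]
    nlinarith

/-! ### The radial kernel and its integrals over planes. -/

lemma integrable_one_div_add_sq {k : ℝ} (hk : k ≠ 0) :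
    Integrable (fun x : ℝ => 1 / (k ^ 2 + x ^ 2)) := by
  refine (integrable_inv_one_add_sq.const_mul ((1 + k ^ 2) / k ^ 2)).mono'
    (Measurable.aestronglyMeasurable (by fun_prop)) (Eventually.of_forall fun x => ?_)
  have : 0 < k ^ 2 := by positivity
  rw [Real.norm_of_nonneg (by positivity), ← div_eq_mul_inv, div_div,
    div_le_div_iff₀ (by positivity) (by positivity)]
  nlinarith [sq_nonneg (k ^ 2), mul_nonneg this.le (sq_nonneg x), sq_nonneg x]

/-- The massless momentum-space kernel at complex time `s` as a function of `q = |p|`. -/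
noncomputable def radialKernel (s : ℂ) (q : ℝ) : ℂ :=
  1 / (4 * (q : ℂ) ^ 3) * Complex.exp (-s * q) * (1 + s * q)

@[fun_prop]
lemma measurable_radialKernel (s : ℂ) : Measurable (radialKernel s) := by
  unfold radialKernel; fun_prop

/-- Write `‖s‖ q = (‖s‖ / s.re) (s.re q)`; the exponential absorbs `s.re q`. -/
lemma norm_radialKernel_le {s : ℂ} (hs : 0 < s.re) {q : ℝ} (hq : 0 < q) :
    ‖radialKernel s q‖ ≤ (1 + ‖s‖ / s.re) / (4 * q ^ 3) := by
  unfold radialKernel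
  rw [norm_mul, norm_mul, Complex.norm_exp, mul_assoc, div_eq_mul_one_div (1 + _), mul_comm (1 + _)]
  have h0 : ‖(1 : ℂ) / (4 * (q : ℂ) ^ 3)‖ = 1 / (4 * q ^ 3) := by
    simp [abs_of_pos hq]
  rw [h0]
  refine mul_le_mul_of_nonneg_left ?_ (by positivity)
  have h1 : ‖1 + s * q‖ ≤ 1 + ‖s‖ * q := by
    refine (norm_add_le _ _).trans ?_
    simp [abs_of_pos hq]
  have h2 : (-s * q).re = -(s.re * q) := by simp
  rw [h2, Real.exp_neg, inv_mul_le_iff₀ (Real.exp_pos _)]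
  have h3 := Real.add_one_le_exp (s.re * q)
  have h4 : ‖s‖ * q = ‖s‖ / s.re * (s.re * q) := by field_simp
  have h5 : 0 ≤ ‖s‖ / s.re := by positivity
  have h6 : 0 < s.re * q := by positivity
  calc _ ≤ 1 + ‖s‖ / s.re * (s.re * q) := by rw [← h4]; exact h1
    _ ≤ Real.exp (s.re * q) * 1 + ‖s‖ / s.re * Real.exp (s.re * q) := by
        gcongr <;> linarith
    _ = _ := by ring

lemma integrableOn_mul_radialKernel {s : ℂ} (hs : 0 < s.re) {k : ℝ} (hk : k ≠ 0) :
    IntegrableOn (fun x : ℝ => (x : ℂ) * radialKernel s (√(k ^ 2 + x ^ 2))) (Ioi 0) := by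
  refine (((integrable_one_div_add_sq hk).const_mul ((1 + ‖s‖ / s.re) / 4)).integrableOn).mono'
    (Measurable.aestronglyMeasurable (by fun_prop)) ?_
  filter_upwards [self_mem_ae_restrict measurableSet_Ioi] with x hx
  have hx : 0 < x := hx
  have hk2 : 0 < k ^ 2 := by positivity
  have hq : 0 < √(k ^ 2 + x ^ 2) := by positivity
  have hxq : x ≤ √(k ^ 2 + x ^ 2) := Real.le_sqrt_of_sq_le (by linarith)
  have hsq : √(k ^ 2 + x ^ 2) ^ 2 = k ^ 2 + x ^ 2 := Real.sq_sqrt (by positivity)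
  have h := norm_radialKernel_le hs hq
  rw [norm_mul, Complex.norm_real, Real.norm_of_nonneg hx.le]
  generalize √(k ^ 2 + x ^ 2) = q at *
  rw [← hsq]
  calc x * ‖radialKernel s q‖ ≤ q * ((1 + ‖s‖ / s.re) / (4 * q ^ 3)) := by gcongr
    _ = _ := by field_simp

/-- With `q = √(k² + x²)` one has `x dx = q dq`, and `q * radialKernel s q` is the derivative of
`-exp(-s q) / (4 q)`. This is what the factor `1 + s q` achieves. -/
lemma integral_mul_radialKernel {s : ℂ} (hs : 0 < s.re) {k : ℝ} (hk : k ≠ 0) :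
    ∫ x in Ioi (0 : ℝ), (x : ℂ) * radialKernel s (√(k ^ 2 + x ^ 2))
      = Complex.exp (-(s * |k|)) / (4 * |k|) := by
  have hk2 : 0 < k ^ 2 := by positivity
  have hqpos : ∀ x : ℝ, 0 < √(k ^ 2 + x ^ 2) := fun x => by positivity
  rw [integral_Ioi_of_hasDerivAt_of_tendsto' (m := 0)
    (f := fun x : ℝ => -(Complex.exp (-(s * (√(k ^ 2 + x ^ 2) : ℝ))) / (4 * (√(k ^ 2 + x ^ 2) : ℝ))))
    ?_ (integrableOn_mul_radialKernel hs hk) ?_]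
  · simp [Real.sqrt_sq_eq_abs]
  · intro x _
    have hq0 : ((√(k ^ 2 + x ^ 2) : ℝ) : ℂ) ≠ 0 := by exact_mod_cast (hqpos x).ne'
    have hd : HasDerivAt (fun x : ℝ => √(k ^ 2 + x ^ 2)) (x / √(k ^ 2 + x ^ 2)) x := by
      have := (((hasDerivAt_id x).pow 2).const_add (k ^ 2)).sqrt (by simp; positivity)
      refine this.congr_deriv ?_
      simp only [id_eq, Pi.pow_apply]
      norm_num
      field_simp
    have hdc := hd.ofReal_comp
    have h := ((hdc.const_mul s).neg.cexp.div (hdc.const_mul 4) (by simpa using (hqpos x).ne')).neg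
    refine h.congr_deriv ?_
    simp only [radialKernel, Pi.neg_apply]
    push_cast
    simp only [neg_mul]
    field_simp
    ring
  · have hlim : Tendsto (fun x : ℝ => √(k ^ 2 + x ^ 2)) atTop atTop :=
      Real.tendsto_sqrt_atTop.comp
        (tendsto_atTop_add_const_left _ _ (tendsto_pow_atTop two_ne_zero))
    have h1 : Tendsto (fun x : ℝ => 1 / (4 * √(k ^ 2 + x ^ 2))) atTop (𝓝 0) := by
      simp only [one_div]
      exact (hlim.const_mul_atTop (show (0 : ℝ) < 4 by norm_num)).inv_tendsto_atTop
    refine squeeze_zero_norm (fun x => ?_) h1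
    have hq := hqpos x
    rw [norm_neg, norm_div, Complex.norm_exp]
    simp only [norm_mul, Complex.norm_real, Real.norm_of_nonneg hq.le, Complex.norm_ofNat]
    gcongr
    rw [Real.exp_le_one_iff]
    simp; positivity

lemma integrable_radialKernel_plane {s : ℂ} (hs : 0 < s.re) {k : ℝ} (hk : k ≠ 0) :
    Integrable (fun w : EuclideanSpace ℝ (Fin 2) => radialKernel s (√(k ^ 2 + ‖w‖ ^ 2))) := by
  rw [integrable_fun_norm_addHaar volume (f := fun x => radialKernel s (√(k ^ 2 + x ^ 2)))]
  simpa using integrableOn_mul_radialKernel hs hk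

lemma integral_radialKernel_plane {s : ℂ} (hs : 0 < s.re) {k : ℝ} (hk : k ≠ 0) :
    ∫ w : EuclideanSpace ℝ (Fin 2), radialKernel s (√(k ^ 2 + ‖w‖ ^ 2))
      = (Real.pi / 2 : ℂ) * (Complex.exp (-(s * |k|)) / |k|) := by
  rw [integral_fun_norm_addHaar volume (fun x => radialKernel s (√(k ^ 2 + x ^ 2)))]
  have h := integral_mul_radialKernel hs hk
  simp only [finrank_euclideanSpace, Fintype.card_fin, Nat.add_one_sub_one, pow_one,
    Complex.real_smul, h, Measure.real, EuclideanSpace.volume_ball_fin_two]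
  have : |k| ≠ 0 := by positivity
  have hpi : (ENNReal.ofReal Real.pi).toReal = Real.pi := ENNReal.toReal_ofReal Real.pi_pos.le
  simp [hpi]
  field_simp
  norm_num

/-! ### The subtracted kernel and its integral over momentum space. -/

/-- Both terms have the same singularity `1 / (4 ‖p‖³)`. In the difference of numerators every term
carries a factor `‖p‖`, either explicitly or by the Lipschitz estimate, so only `‖p‖⁻²` remains. -/
lemma norm_radialKernel_sub_le {s : ℂ} {δ : ℝ} (hs : δ ≤ s.re) (h1 : δ ≤ 1)
    (p y : EuclideanSpace ℝ (Fin 3)) :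
    ‖radialKernel s ‖p‖ * Complex.exp (Complex.I * (inner ℝ p y : ℝ)) - radialKernel 1 ‖p‖‖
      ≤ (2 * ‖s‖ + ‖y‖ + 2) * (Real.exp (-δ * ‖p‖) / ‖p‖ ^ 2) := by
  rcases eq_or_ne p 0 with rfl | hp
  -- Division by zero makes both sides vanish.
  · simp [radialKernel]
  have hq : 0 < ‖p‖ := norm_pos_iff.2 hp
  have hin : |inner ℝ p y| ≤ ‖p‖ * ‖y‖ := abs_real_inner_le_norm p y
  generalize inner ℝ p y = c at *
  generalize ‖p‖ = q at *
  set a : ℂ := -s * q + Complex.I * c with ha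
  set b : ℂ := -1 * q with hb
  have hare : a.re ≤ -δ * q := by simp [ha]; nlinarith
  have hbre : b.re ≤ -δ * q := by simp [hb]; nlinarith
  have hab : ‖Complex.exp a - Complex.exp b‖ ≤ Real.exp (-δ * q) * ((‖s‖ + ‖y‖ + 1) * q) := by
    refine (norm_cexp_sub_cexp_le hare hbre).trans ?_
    gcongr
    calc ‖a - b‖ = ‖-s * q + Complex.I * c + q‖ := by rw [ha, hb]; ring_nf
      _ ≤ ‖-s * q‖ + ‖Complex.I * c‖ + ‖(q : ℂ)‖ := norm_add₃_le
      _ ≤ ‖s‖ * q + q * ‖y‖ + q := by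
          simp only [norm_mul, norm_neg, Complex.norm_real, Complex.norm_I, Real.norm_eq_abs,
            abs_of_pos hq, one_mul]
          gcongr
      _ = _ := by ring
  have hea : ‖s * q * Complex.exp a‖ ≤ Real.exp (-δ * q) * (‖s‖ * q) := by
    rw [norm_mul, norm_mul, Complex.norm_real, Real.norm_of_nonneg hq.le, Complex.norm_exp, mul_comm]
    gcongr
  have heb : ‖q * Complex.exp b‖ ≤ Real.exp (-δ * q) * q := by
    rw [norm_mul, Complex.norm_real, Real.norm_of_nonneg hq.le, Complex.norm_exp, mul_comm]
    gcongr
  have hid : radialKernel s q * Complex.exp (Complex.I * c) - radialKernel 1 q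
      = 1 / (4 * (q : ℂ) ^ 3) *
        ((Complex.exp a - Complex.exp b) + s * q * Complex.exp a - q * Complex.exp b) := by
    rw [ha, Complex.exp_add, hb]
    unfold radialKernel
    ring
  have h0 : ‖(1 : ℂ) / (4 * (q : ℂ) ^ 3)‖ = 1 / (4 * q ^ 3) := by simp [abs_of_pos hq]
  rw [hid, norm_mul, h0]
  have hsum := (norm_sub_le (Complex.exp a - Complex.exp b + s * q * Complex.exp a)
    (q * Complex.exp b)).trans (add_le_add_left (norm_add_le _ _) _)
  have hE : 0 < Real.exp (-δ * q) := Real.exp_pos _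
  calc _ ≤ 1 / (4 * q ^ 3) * (Real.exp (-δ * q) * ((2 * ‖s‖ + ‖y‖ + 2) * q)) := by
        gcongr
        linarith
    _ = (2 * ‖s‖ + ‖y‖ + 2) * (Real.exp (-δ * q) / q ^ 2) / 4 := by field_simp
    _ ≤ _ := div_le_self (by positivity) (by norm_num)

lemma integrable_exp_div_sq {δ : ℝ} (hδ : 0 < δ) :
    Integrable (fun p : EuclideanSpace ℝ (Fin 3) => Real.exp (-δ * ‖p‖) / ‖p‖ ^ 2) := by
  rw [integrable_fun_norm_addHaar volume (f := fun x => Real.exp (-δ * x) / x ^ 2)]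
  refine (integrableOn_exp_mul_Ioi (a := -δ) (by linarith) 0).congr_fun (fun x hx => ?_)
    measurableSet_Ioi
  have hx : (0 : ℝ) < x := hx
  simp
  field_simp

lemma integrable_radialKernel_sub {s : ℂ} (hs : 0 < s.re) (y : EuclideanSpace ℝ (Fin 3)) :
    Integrable (fun p : EuclideanSpace ℝ (Fin 3) =>
      radialKernel s ‖p‖ * Complex.exp (Complex.I * (inner ℝ p y : ℝ)) - radialKernel 1 ‖p‖) :=
  ((integrable_exp_div_sq (lt_min hs one_pos)).const_mul (2 * ‖s‖ + ‖y‖ + 2)).mono'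
    (Measurable.aestronglyMeasurable (by fun_prop))
    (Eventually.of_forall fun p => norm_radialKernel_sub_le (min_le_left _ _) (min_le_right _ _) p y)

/-- Splitting off the first coordinate of Euclidean three-space. -/
noncomputable def splitFirst :
    EuclideanSpace ℝ (Fin 3) ≃ᵐ ℝ × EuclideanSpace ℝ (Fin 2) :=
  (MeasurableEquiv.toLp 2 (Fin 3 → ℝ)).symm.trans
    ((MeasurableEquiv.piFinSuccAbove (fun _ => ℝ) 0).trans
      ((MeasurableEquiv.refl ℝ).prodCongr (MeasurableEquiv.toLp 2 (Fin 2 → ℝ))))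

lemma measurePreserving_splitFirst : MeasurePreserving splitFirst :=
  ((MeasurePreserving.id volume).prod (PiLp.volume_preserving_toLp (Fin 2))).comp
    ((volume_preserving_piFinSuccAbove (fun _ : Fin 3 => ℝ) 0).comp
      (PiLp.volume_preserving_ofLp (Fin 3)))

lemma splitFirst_fst (p : EuclideanSpace ℝ (Fin 3)) : (splitFirst p).1 = p 0 := rfl

lemma norm_splitFirst (p : EuclideanSpace ℝ (Fin 3)) :
    √((splitFirst p).1 ^ 2 + ‖(splitFirst p).2‖ ^ 2) = ‖p‖ := by
  rw [EuclideanSpace.norm_eq p, EuclideanSpace.norm_sq_eq, Fin.sum_univ_succ (n := 2)]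
  simp only [splitFirst_fst, Real.norm_eq_abs, sq_abs]
  rfl

/-- The half-lines `k > 0` and `k < 0` give Frullani integrals with parameters `s - i r` and `s + i
r`. -/
lemma integral_cexp_sub_cexp_div_abs {s : ℂ} (hs : 0 < s.re) (r : ℝ) :
    ∫ k : ℝ, (Complex.exp (-(s * |k|)) / |k| * Complex.exp (Complex.I * (k * r))
        - Complex.exp (-(1 * |k|)) / |k|)
      = -(Complex.log (s - Complex.I * r) + Complex.log (s + Complex.I * r)) := by
  set F : ℝ → ℂ := fun k => Complex.exp (-(s * |k|)) / |k| * Complex.exp (Complex.I * (k * r))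
        - Complex.exp (-(1 * |k|)) / |k| with hF
  have hm : 0 < (s - Complex.I * r).re := by simpa using hs
  have hp : 0 < (s + Complex.I * r).re := by simpa using hs
  have e1 : EqOn F (fun k : ℝ => (Complex.exp (-((s - Complex.I * r) * k))
      - Complex.exp (-(1 * k))) / k) (Ioi 0) := by
    intro k hk
    simp only [hF, abs_of_pos (mem_Ioi.1 hk)]
    rw [show -((s - Complex.I * r) * (k : ℂ)) = -(s * k) + Complex.I * (k * r) by ring,
      Complex.exp_add]
    ring
  have e2 : EqOn (fun k => F (-k)) (fun k : ℝ => (Complex.exp (-((s + Complex.I * r) * k))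
      - Complex.exp (-(1 * k))) / k) (Ioi 0) := by
    intro k hk
    simp only [hF, abs_neg, abs_of_pos (mem_Ioi.1 hk)]
    rw [show -((s + Complex.I * r) * (k : ℂ)) = -(s * k) + Complex.I * ((-k : ℝ) * r) by
      push_cast; ring, Complex.exp_add]
    ring
  have i1 : IntegrableOn F (Ioi 0) :=
    (integrableOn_cexp_sub_cexp_div hm (by simp)).congr_fun e1.symm measurableSet_Ioi
  have i2 : IntegrableOn (fun k => F (-k)) (Ioi 0) :=
    (integrableOn_cexp_sub_cexp_div hp (by simp)).congr_fun e2.symm measurableSet_Ioi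
  have i3 : IntegrableOn F (Iic 0) := by
    rw [integrableOn_Iic_iff_integrableOn_Iio,
      ← (Measure.measurePreserving_neg (volume : Measure ℝ)).integrableOn_comp_preimage
        (Homeomorph.neg ℝ).measurableEmbedding]
    simpa [Function.comp_def] using i2
  rw [← intervalIntegral.integral_Iic_add_Ioi i3 i1, setIntegral_congr_fun measurableSet_Ioi e1,
    integral_cexp_sub_cexp_div hm]
  have h2 := integral_comp_neg_Ioi 0 F
  rw [neg_zero, setIntegral_congr_fun measurableSet_Ioi e2, integral_cexp_sub_cexp_div hp] at h2
  rw [← h2]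
  ring

lemma integral_radialKernel_sub_axis {s : ℂ} (hs : 0 < s.re) (r : ℝ) :
    ∫ p : EuclideanSpace ℝ (Fin 3),
      (radialKernel s ‖p‖ * Complex.exp (Complex.I * (p 0 * r)) - radialKernel 1 ‖p‖)
      = -(Real.pi / 2) * (Complex.log (s - Complex.I * r) + Complex.log (s + Complex.I * r)) := by
  set H : ℝ × EuclideanSpace ℝ (Fin 2) → ℂ := fun z =>
    radialKernel s (√(z.1 ^ 2 + ‖z.2‖ ^ 2)) * Complex.exp (Complex.I * (z.1 * r))
      - radialKernel 1 (√(z.1 ^ 2 + ‖z.2‖ ^ 2)) with hH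
  have hcomp : ∀ p : EuclideanSpace ℝ (Fin 3), H (splitFirst p) =
      radialKernel s ‖p‖ * Complex.exp (Complex.I * (p 0 * r)) - radialKernel 1 ‖p‖ := by
    intro p
    simp only [hH, norm_splitFirst]
    rw [splitFirst_fst]
  have hint : Integrable H := by
    rw [← measurePreserving_splitFirst.integrable_comp_emb splitFirst.measurableEmbedding]
    refine (integrable_radialKernel_sub hs (EuclideanSpace.single 0 r)).congr
      (Eventually.of_forall fun p => ?_)
    simp only [Function.comp_apply, hcomp]
    congr 4
    simp [EuclideanSpace.inner_single_right, mul_comm]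
  simp_rw [← hcomp]
  rw [measurePreserving_splitFirst.integral_comp splitFirst.measurableEmbedding H,
    Measure.volume_eq_prod, integral_prod _ hint, neg_mul, ← mul_neg,
    ← integral_cexp_sub_cexp_div_abs hs r, ← integral_const_mul]
  refine integral_congr_ae ?_
  -- The plane through the origin, to which the plane formula does not apply, is a null slice.
  filter_upwards [Measure.ae_ne volume (0 : ℝ)] with k hk
  simp only [hH]
  rw [integral_sub ((integrable_radialKernel_plane hs hk).mul_const _)
    (integrable_radialKernel_plane (by simp) hk), integral_mul_const,
    integral_radialKernel_plane hs hk, integral_radialKernel_plane (by simp) hk]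
  ring

/-- The subtracted inverse Fourier transform of the massless kernel. -/
lemma integral_radialKernel_sub {s : ℂ} (hs : 0 < s.re) (y : EuclideanSpace ℝ (Fin 3)) :
    ∫ p : EuclideanSpace ℝ (Fin 3),
      (radialKernel s ‖p‖ * Complex.exp (Complex.I * (inner ℝ p y : ℝ)) - radialKernel 1 ‖p‖)
      = -(Real.pi / 2) *
        (Complex.log (s - Complex.I * ‖y‖) + Complex.log (s + Complex.I * ‖y‖)) := by
  set e : EuclideanSpace ℝ (Fin 3) := EuclideanSpace.single 0 ‖y‖ with he
  have hn : ‖e‖ = ‖y‖ := by simp [he]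
  -- The Householder reflection taking `e` to `y`.
  set R := (ℝ ∙ (e - y))ᗮ.reflection with hR
  have hRe : R e = y := Submodule.reflection_sub hn
  rw [← integral_radialKernel_sub_axis hs,
    ← R.measurePreserving.integral_comp R.toHomeomorph.measurableEmbedding]
  refine integral_congr_ae (Eventually.of_forall fun p => ?_)
  have : inner ℝ (R p) y = p 0 * ‖y‖ := by
    rw [← hRe, R.inner_map_map]
    simp [he, EuclideanSpace.inner_single_right, mul_comm]
  simp [this]

/-! ### On-shell Fourier integrals: behaviour at the origin and at infinity. -/

/-- The Fourier integral of `g` at the on-shell momentum `σ (|p|, p)`. -/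
noncomputable def onShellFourier (g : Spacetime → ℂ) (σ : ℝ) (p : EuclideanSpace ℝ (Fin 3)) : ℂ :=
  ∫ x : Spacetime, g x * Complex.exp (Complex.I * (σ * (inner ℝ p x.2 - ‖p‖ * x.1) : ℝ))

lemma norm_cexp_I_mul (θ : ℝ) : ‖Complex.exp (Complex.I * θ)‖ = 1 := by
  rw [mul_comm]; exact Complex.norm_exp_ofReal_mul_I θ

lemma integrable_mul_phase {g : Spacetime → ℂ} (hg : Continuous g) (hs : HasCompactSupport g)
    (σ : ℝ) (p : EuclideanSpace ℝ (Fin 3)) :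
    Integrable (fun x : Spacetime =>
      g x * Complex.exp (Complex.I * (σ * (inner ℝ p x.2 - ‖p‖ * x.1) : ℝ))) :=
  Continuous.integrable_of_hasCompactSupport (by fun_prop) hs.mul_right

lemma measurable_onShellFourier {g : Spacetime → ℂ} (hg : Continuous g) (σ : ℝ) :
    Measurable (onShellFourier g σ) := by
  have h : Continuous (Function.uncurry fun (p : EuclideanSpace ℝ (Fin 3)) (x : Spacetime) =>
      g x * Complex.exp (Complex.I * (σ * (inner ℝ p x.2 - ‖p‖ * x.1) : ℝ))) := by
    unfold Function.uncurry; fun_prop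
  exact (h.stronglyMeasurable.integral_prod_right (ν := volume)).measurable

lemma exists_norm_onShellFourier_le (g : Spacetime → ℂ) (σ : ℝ) :
    ∃ C : ℝ, ∀ p, ‖onShellFourier g σ p‖ ≤ C := by
  refine ⟨∫ x, ‖g x‖, fun p => (norm_integral_le_integral_norm _).trans (le_of_eq ?_)⟩
  simp only [norm_mul, norm_cexp_I_mul, mul_one]

/-- The vanishing mean allows `1` to be subtracted from the phase factor, and the phase is linear in
the size of `p`. -/
lemma exists_norm_onShellFourier_le_mul {g : Spacetime → ℂ} (hg : Continuous g)
    (hs : HasCompactSupport g) (h0 : ∫ x, g x = 0) (σ : ℝ) :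
    ∃ C : ℝ, ∀ p, ‖onShellFourier g σ p‖ ≤ C * ‖p‖ := by
  refine ⟨∫ x, ‖g x‖ * (|σ| * (‖x.2‖ + |x.1|)), fun p => ?_⟩
  have hsub : onShellFourier g σ p = ∫ x : Spacetime,
      g x * (Complex.exp (Complex.I * (σ * (inner ℝ p x.2 - ‖p‖ * x.1) : ℝ)) - 1) := by
    simp only [mul_sub (g _), mul_one]
    rw [integral_sub (integrable_mul_phase hg hs σ p) (hg.integrable_of_hasCompactSupport hs), h0,
      sub_zero, onShellFourier]
  rw [hsub, ← integral_mul_const]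
  refine norm_integral_le_of_norm_le ?_ (Eventually.of_forall fun x => ?_)
  · refine Continuous.integrable_of_hasCompactSupport (by fun_prop) ?_
    exact (hs.norm.mul_right).mul_right
  · rw [norm_mul, mul_assoc]
    gcongr
    have h1 := norm_cexp_sub_cexp_le
      (z := Complex.I * (σ * (inner ℝ p x.2 - ‖p‖ * x.1) : ℝ)) (w := 0) (m := 0) (by simp) (by simp)
    rw [Complex.exp_zero, Real.exp_zero, one_mul, sub_zero, norm_mul, Complex.norm_I, one_mul,
      Complex.norm_real, Real.norm_eq_abs, abs_mul] at h1
    refine h1.trans ?_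
    rw [mul_assoc]
    gcongr
    refine (abs_sub _ _).trans ?_
    rw [abs_mul, abs_norm]
    nlinarith [abs_real_inner_le_norm p x.2]

instance isAddHaarMeasure_volume_spacetime : (volume : Measure Spacetime).IsAddHaarMeasure :=
  Measure.prod.instIsAddHaarMeasure volume volume

/-- Integrate by parts in time: on shell the frequency is exactly `±‖p‖`, so one time derivative
yields the factor `‖p‖` in every direction of `p`. -/
lemma exists_norm_mul_norm_onShellFourier_le {g : Spacetime → ℂ} (hg : ContDiff ℝ 1 g)
    (hs : HasCompactSupport g) {σ : ℝ} (hσ : |σ| = 1) :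
    ∃ C : ℝ, ∀ p, ‖p‖ * ‖onShellFourier g σ p‖ ≤ C := by
  refine ⟨∫ x, ‖fderiv ℝ g x (1, 0)‖, fun p => ?_⟩
  set e : Spacetime → ℂ := fun x =>
    Complex.exp (Complex.I * (σ * (inner ℝ p x.2 - ‖p‖ * x.1) : ℝ)) with he
  have hed : Differentiable ℝ e := by
    have hi : Differentiable ℝ fun x : Spacetime => inner ℝ p x.2 :=
      (differentiable_const p).inner ℝ differentiable_snd
    simp only [he]
    fun_prop
  have hde : ∀ x, fderiv ℝ e x (1, 0) = e x * (-(Complex.I * (σ * ‖p‖))) := by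
    intro x
    rw [← (hed x).lineDeriv_eq_fderiv]
    refine HasLineDerivAt.lineDeriv ?_
    unfold HasLineDerivAt
    have h1 : HasDerivAt (fun t : ℝ => σ * (inner ℝ p x.2 - ‖p‖ * (x.1 + t))) (-(σ * ‖p‖)) 0 := by
      have := ((((hasDerivAt_id (0 : ℝ)).const_add x.1).const_mul ‖p‖).const_sub
        (inner ℝ p x.2)).const_mul σ
      refine this.congr_deriv (by simp)
    have h2 := (h1.ofReal_comp.const_mul Complex.I).cexp
    simp only [add_zero] at h2
    have hfun : (fun t : ℝ => e (x + t • ((1 : ℝ), (0 : EuclideanSpace ℝ (Fin 3)))))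
        = fun t : ℝ => Complex.exp (Complex.I * (σ * (inner ℝ p x.2 - ‖p‖ * (x.1 + t)) : ℝ)) := by
      funext t; simp [he]
    rw [hfun]
    exact h2.congr_deriv (by simp [he])
  have hcd : Continuous fun x => fderiv ℝ g x (1, 0) :=
    (hg.continuous_fderiv one_ne_zero).clm_apply continuous_const
  have hsd : HasCompactSupport fun x => fderiv ℝ g x (1, 0) := hs.fderiv_apply ℝ (1, 0)
  have hec : Continuous e := hed.continuous
  have hibp := integral_mul_fderiv_eq_neg_fderiv_mul_of_integrable (μ := volume) (f := g) (g := e)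
    (v := ((1 : ℝ), (0 : EuclideanSpace ℝ (Fin 3))))
    (Continuous.integrable_of_hasCompactSupport (hcd.mul hec) hsd.mul_right)
    (by
      simp_rw [hde]
      exact Continuous.integrable_of_hasCompactSupport
        (hg.continuous.mul (hec.mul continuous_const)) hs.mul_right)
    (Continuous.integrable_of_hasCompactSupport (hg.continuous.mul hec) hs.mul_right)
    (fun x _ => hg.differentiable one_ne_zero x) (fun x _ => hed x)
  simp_rw [hde, ← mul_assoc] at hibp
  rw [integral_mul_const] at hibp
  have hn := congrArg norm hibp
  rw [norm_mul, norm_neg, norm_neg, norm_mul, norm_mul, Complex.norm_I, Complex.norm_real,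
    Complex.norm_real, Real.norm_eq_abs, hσ, one_mul, one_mul, norm_norm, mul_comm] at hn
  change ‖p‖ * ‖∫ x, g x * e x‖ ≤ _
  rw [hn]
  refine (norm_integral_le_integral_norm _).trans (le_of_eq ?_)
  simp only [norm_mul, he, norm_cexp_I_mul, mul_one]

/-! ### The regularised smearing and a bound uniform in the regulator. -/

/-- `φ` is `id` for integrands and `norm` for their majorants. -/
lemma hasCompactSupport_tensor {f : Spacetime → ℂ} (hs : HasCompactSupport f)
    {β : Type*} [MulZeroClass β] (φ : ℂ → β) (hφ : φ 0 = 0) (k : Spacetime × Spacetime → β) :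
    HasCompactSupport fun z : Spacetime × Spacetime => φ (f z.1 * f z.2) * k z := by
  refine HasCompactSupport.intro (hs.isCompact.prod hs.isCompact) fun z hz => ?_
  have : f z.1 * f z.2 = 0 := by
    by_contra h
    exact hz ⟨subset_tsupport f (left_ne_zero_of_mul h), subset_tsupport f (right_ne_zero_of_mul h)⟩
  rw [this, hφ, zero_mul]

/-- The regularised kernel at regulator `ε`, fixed `p`, as a function of `(x, x')`. -/
noncomputable def regularizedKernel (ε : ℝ) (p : EuclideanSpace ℝ (Fin 3))
    (z : Spacetime × Spacetime) : ℂ :=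
  radialKernel (ε + Complex.I * (z.1.1 - z.2.1 : ℝ)) ‖p‖ *
    Complex.exp (Complex.I * (inner ℝ p (z.1.2 - z.2.2) : ℝ))

@[fun_prop]
lemma continuous_regularizedKernel (ε : ℝ) (p : EuclideanSpace ℝ (Fin 3)) :
    Continuous (regularizedKernel ε p) := by
  unfold regularizedKernel radialKernel
  fun_prop

/-- The regularised kernel paired with `f ⊗ f`. -/
noncomputable def regularizedSmearing (f : Spacetime → ℂ) (ε : ℝ)
    (p : EuclideanSpace ℝ (Fin 3)) : ℂ :=
  ∫ z : Spacetime × Spacetime, f z.1 * f z.2 * regularizedKernel ε p z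

lemma regularizedSmearing_zero {f : Spacetime → ℂ} (hf : Continuous f) (hs : HasCompactSupport f)
    (p : EuclideanSpace ℝ (Fin 3)) : regularizedSmearing f 0 p = smearedKernel f p := by
  unfold regularizedSmearing smearedKernel
  rw [Measure.volume_eq_prod, integral_prod]
  · refine integral_congr_ae (Eventually.of_forall fun x => ?_)
    refine integral_congr_ae (Eventually.of_forall fun x' => ?_)
    simp only [regularizedKernel, radialKernel, momentumKernel]
    push_cast
    rw [show -(0 + Complex.I * ((x.1 : ℂ) - x'.1)) * ‖p‖
      = -Complex.I * ‖p‖ * ((x.1 : ℂ) - x'.1) by ring]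
    ring
  · exact Continuous.integrable_of_hasCompactSupport (by fun_prop)
      (hasCompactSupport_tensor hs id rfl _)

/-- The phase is a product of a function of `x` and one of `x'`, and the factor `t - t'` splits into
two terms, so the double integral factorises. -/
lemma regularizedSmearing_eq {f : Spacetime → ℂ} (hf : Continuous f) (hs : HasCompactSupport f)
    (ε : ℝ) (p : EuclideanSpace ℝ (Fin 3)) :
    regularizedSmearing f ε p = Complex.exp (-ε * ‖p‖ : ℝ) / (4 * (‖p‖ : ℂ) ^ 3) *
      ((1 + ε * ‖p‖ : ℝ) * (onShellFourier f 1 p * onShellFourier f (-1) p) +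
        Complex.I * ‖p‖ *
          (onShellFourier (fun x => x.1 * f x) 1 p * onShellFourier f (-1) p
            - onShellFourier f 1 p * onShellFourier (fun x => x.1 * f x) (-1) p)) := by
  have hft : Continuous fun x : Spacetime => (x.1 : ℂ) * f x := by fun_prop
  have hst : HasCompactSupport fun x : Spacetime => (x.1 : ℂ) * f x := hs.mul_left
  unfold onShellFourier
  rw [← integral_prod_mul, ← integral_prod_mul, ← integral_prod_mul,
    ← integral_sub ((integrable_mul_phase hft hst 1 p).mul_prod (integrable_mul_phase hf hs (-1) p))
      ((integrable_mul_phase hf hs 1 p).mul_prod (integrable_mul_phase hft hst (-1) p)),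
    ← integral_const_mul, ← integral_const_mul,
    ← integral_add
      (((integrable_mul_phase hf hs 1 p).mul_prod (integrable_mul_phase hf hs (-1) p)).const_mul _)
      (Integrable.const_mul
        (((integrable_mul_phase hft hst 1 p).mul_prod (integrable_mul_phase hf hs (-1) p)).sub'
        ((integrable_mul_phase hf hs 1 p).mul_prod (integrable_mul_phase hft hst (-1) p))) _),
    ← integral_const_mul]
  unfold regularizedSmearing
  rw [Measure.volume_eq_prod]
  refine integral_congr_ae (Eventually.of_forall fun z => ?_)
  simp only [regularizedKernel, radialKernel]
  have hexp : Complex.exp (-(ε + Complex.I * (z.1.1 - z.2.1 : ℝ)) * ‖p‖) *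
      Complex.exp (Complex.I * (inner ℝ p (z.1.2 - z.2.2) : ℝ))
      = Complex.exp (-ε * ‖p‖ : ℝ) *
        (Complex.exp (Complex.I * (1 * (inner ℝ p z.1.2 - ‖p‖ * z.1.1) : ℝ)) *
        Complex.exp (Complex.I * (-1 * (inner ℝ p z.2.2 - ‖p‖ * z.2.1) : ℝ))) := by
    rw [← Complex.exp_add, ← Complex.exp_add, ← Complex.exp_add, inner_sub_right]
    congr 1
    push_cast
    ring
  calc _ = f z.1 * f z.2 * (1 / (4 * (‖p‖ : ℂ) ^ 3) *
        (1 + (ε + Complex.I * (z.1.1 - z.2.1 : ℝ)) * ‖p‖)) *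
        (Complex.exp (-(ε + Complex.I * (z.1.1 - z.2.1 : ℝ)) * ‖p‖) *
      Complex.exp (Complex.I * (inner ℝ p (z.1.2 - z.2.2) : ℝ))) := by ring
    _ = _ := by
      rw [hexp]
      push_cast
      ring

lemma measurable_regularizedSmearing {f : Spacetime → ℂ} (hf : Continuous f)
    (hs : HasCompactSupport f) (ε : ℝ) : Measurable (regularizedSmearing f ε) := by
  have hft : Continuous fun x : Spacetime => (x.1 : ℂ) * f x := by fun_prop
  have h1 := measurable_onShellFourier hf 1
  have h2 := measurable_onShellFourier hf (-1)
  have h3 := measurable_onShellFourier hft 1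
  have h4 := measurable_onShellFourier hft (-1)
  rw [funext (regularizedSmearing_eq hf hs ε)]
  fun_prop

lemma exists_norm_onShellFourier_le_div {g : Spacetime → ℂ} (hg : ContDiff ℝ 1 g)
    (hs : HasCompactSupport g) {σ : ℝ} (hσ : |σ| = 1) :
    ∃ C : ℝ, 0 ≤ C ∧ ∀ p, ‖onShellFourier g σ p‖ ≤ C / (1 + ‖p‖) := by
  obtain ⟨C₁, h₁⟩ := exists_norm_onShellFourier_le g σ
  obtain ⟨C₂, h₂⟩ := exists_norm_mul_norm_onShellFourier_le hg hs hσ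
  have hle : ∀ p, ‖onShellFourier g σ p‖ * (1 + ‖p‖) ≤ C₁ + C₂ := fun p => by
    linarith [h₁ p, h₂ p]
  exact ⟨C₁ + C₂, le_trans (by positivity) (hle 0), fun p => (le_div_iff₀ (by positivity)).2 (hle p)⟩

lemma exists_norm_onShellFourier_le_of_integral_eq_zero {g : Spacetime → ℂ} (hg : ContDiff ℝ 1 g)
    (hs : HasCompactSupport g) (h0 : ∫ x, g x = 0) {σ : ℝ} (hσ : |σ| = 1) :
    ∃ C : ℝ, 0 ≤ C ∧ ∀ p, ‖onShellFourier g σ p‖ ≤ C * ‖p‖ / (1 + ‖p‖ ^ 2) := by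
  obtain ⟨C₁, h₁⟩ := exists_norm_onShellFourier_le_mul hg.continuous hs h0 σ
  obtain ⟨C₂, h₂⟩ := exists_norm_mul_norm_onShellFourier_le hg hs hσ
  refine ⟨|C₁| + |C₂|, by positivity, fun p => (le_div_iff₀ (by positivity)).2 ?_⟩
  have h₁' := h₁ p
  have h₂' := mul_le_mul_of_nonneg_left (h₂ p) (norm_nonneg p)
  nlinarith [mul_le_mul_of_nonneg_left (le_abs_self C₁) (norm_nonneg p),
    mul_le_mul_of_nonneg_left (le_abs_self C₂) (norm_nonneg p)]

lemma integrable_one_div_sq_mul :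
    Integrable fun p : EuclideanSpace ℝ (Fin 3) => 1 / (‖p‖ ^ 2 * (1 + ‖p‖ ^ 2)) := by
  rw [integrable_fun_norm_addHaar volume (f := fun x => 1 / (x ^ 2 * (1 + x ^ 2)))]
  refine integrable_inv_one_add_sq.integrableOn.congr_fun (fun x hx => ?_) measurableSet_Ioi
  have hx : (0 : ℝ) < x := hx
  simp
  field_simp

/-- The function `t f` need not have mean zero, but its transform always comes with an explicit
`‖p‖` and a transform of `f`. Uniformity in `ε` rests on `exp(-ε q) (1 + ε q) ≤ 1`. -/
lemma exists_norm_regularizedSmearing_le {f : Spacetime → ℂ} (hf : ContDiff ℝ 1 f)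
    (hs : HasCompactSupport f) (h0 : ∫ x, f x = 0) :
    ∃ C : ℝ, ∀ ε, 0 ≤ ε → ∀ p,
      ‖regularizedSmearing f ε p‖ ≤ C * (1 / (‖p‖ ^ 2 * (1 + ‖p‖ ^ 2))) := by
  have hft : ContDiff ℝ 1 fun x : Spacetime => (x.1 : ℂ) * f x :=
    (Complex.ofRealCLM.contDiff.comp contDiff_fst).mul hf
  have hst : HasCompactSupport fun x : Spacetime => (x.1 : ℂ) * f x := hs.mul_left
  obtain ⟨C₁, p₁, h₁⟩ := exists_norm_onShellFourier_le_of_integral_eq_zero hf hs h0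
    (σ := 1) (by simp)
  obtain ⟨C₂, p₂, h₂⟩ := exists_norm_onShellFourier_le_of_integral_eq_zero hf hs h0
    (σ := -1) (by simp)
  obtain ⟨C₃, p₃, h₃⟩ := exists_norm_onShellFourier_le_div hft hst (σ := 1) (by simp)
  obtain ⟨C₄, p₄, h₄⟩ := exists_norm_onShellFourier_le_div hft hst (σ := -1) (by simp)
  refine ⟨C₁ * C₂ + C₃ * C₂ + C₁ * C₄, fun ε hε p => ?_⟩
  rcases eq_or_ne p 0 with rfl | hp
  · simp [regularizedSmearing, regularizedKernel, radialKernel]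
  have hq : 0 < ‖p‖ := norm_pos_iff.2 hp
  rw [regularizedSmearing_eq hf.continuous hs]
  have h₁ := h₁ p
  have h₂ := h₂ p
  have h₃ := h₃ p
  have h₄ := h₄ p
  generalize onShellFourier f 1 p = A at *
  generalize onShellFourier f (-1) p = B at *
  generalize onShellFourier (fun x => x.1 * f x) 1 p = A' at *
  generalize onShellFourier (fun x => x.1 * f x) (-1) p = B' at *
  generalize ‖p‖ = q at *
  have e1 : Real.exp (-ε * q) ≤ 1 := Real.exp_le_one_iff.2 (by nlinarith)
  have e2 : Real.exp (-ε * q) * (1 + ε * q) ≤ 1 := by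
    rw [neg_mul, Real.exp_neg, inv_mul_le_iff₀ (Real.exp_pos _), mul_one, add_comm]
    exact Real.add_one_le_exp _
  have e0 : 0 ≤ Real.exp (-ε * q) := (Real.exp_pos _).le
  have hAB : ‖A‖ * ‖B‖ ≤ C₁ * C₂ * q / (1 + q ^ 2) := by
    calc _ ≤ (C₁ * q / (1 + q ^ 2)) * (C₂ * q / (1 + q ^ 2)) := by gcongr
      _ = C₁ * C₂ * q / (1 + q ^ 2) * (q / (1 + q ^ 2)) := by field_simp
      _ ≤ _ := mul_le_of_le_one_right (by positivity)
        ((div_le_one (by positivity)).2 (by nlinarith [sq_nonneg (q - 1)]))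
  have hq1 : q / (1 + q) ≤ 1 := (div_le_one (by positivity)).2 (by linarith)
  have hAB' : q * (‖A'‖ * ‖B‖) ≤ C₃ * C₂ * q / (1 + q ^ 2) := by
    calc _ ≤ q * ((C₃ / (1 + q)) * (C₂ * q / (1 + q ^ 2))) := by gcongr
      _ = C₃ * C₂ * q / (1 + q ^ 2) * (q / (1 + q)) := by field_simp
      _ ≤ _ := mul_le_of_le_one_right (by positivity) hq1
  have hBA' : q * (‖A‖ * ‖B'‖) ≤ C₁ * C₄ * q / (1 + q ^ 2) := by
    calc _ ≤ q * ((C₁ * q / (1 + q ^ 2)) * (C₄ / (1 + q))) := by gcongr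
      _ = C₁ * C₄ * q / (1 + q ^ 2) * (q / (1 + q)) := by field_simp
      _ ≤ _ := mul_le_of_le_one_right (by positivity) hq1
  have h0 : ‖(Complex.exp (-ε * q : ℝ) / (4 * (q : ℂ) ^ 3))‖ = Real.exp (-ε * q) / (4 * q ^ 3) := by
    rw [norm_div, Complex.norm_exp, Complex.ofReal_re]
    simp [abs_of_pos hq]
  have n1 : ‖((1 + ε * q : ℝ) : ℂ) * (A * B)‖ = (1 + ε * q) * (‖A‖ * ‖B‖) := by
    rw [norm_mul, norm_mul, Complex.norm_real, Real.norm_of_nonneg (by positivity)]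
  have n2 : ‖Complex.I * q * (A' * B - A * B')‖ ≤ q * (‖A'‖ * ‖B‖) + q * (‖A‖ * ‖B'‖) := by
    rw [norm_mul, norm_mul, Complex.norm_I, one_mul, Complex.norm_real, Real.norm_of_nonneg hq.le,
      ← mul_add, ← norm_mul, ← norm_mul]
    gcongr
    exact norm_sub_le _ _
  rw [norm_mul, h0]
  set S := ((1 + ε * q : ℝ) : ℂ) * (A * B) + Complex.I * q * (A' * B - A * B')
  have hS : ‖S‖ ≤ (1 + ε * q) * (‖A‖ * ‖B‖) + (q * (‖A'‖ * ‖B‖) + q * (‖A‖ * ‖B'‖)) :=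
    (norm_add_le _ _).trans (add_le_add n1.le n2)
  have hES : Real.exp (-ε * q) * ‖S‖ ≤ (C₁ * C₂ + C₃ * C₂ + C₁ * C₄) * (q / (1 + q ^ 2)) := by
    calc _ ≤ Real.exp (-ε * q) *
          ((1 + ε * q) * (‖A‖ * ‖B‖) + (q * (‖A'‖ * ‖B‖) + q * (‖A‖ * ‖B'‖))) := by gcongr
      _ = (Real.exp (-ε * q) * (1 + ε * q)) * (‖A‖ * ‖B‖) +
          Real.exp (-ε * q) * (q * (‖A'‖ * ‖B‖) + q * (‖A‖ * ‖B'‖)) := by ring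
      _ ≤ 1 * (C₁ * C₂ * q / (1 + q ^ 2)) +
          1 * (C₃ * C₂ * q / (1 + q ^ 2) + C₁ * C₄ * q / (1 + q ^ 2)) := by gcongr
      _ = _ := by ring
  calc _ = Real.exp (-ε * q) * ‖S‖ / (4 * q ^ 3) := by ring
    _ ≤ (C₁ * C₂ + C₃ * C₂ + C₁ * C₄) * (q / (1 + q ^ 2)) / (4 * q ^ 3) := by gcongr
    _ = (C₁ * C₂ + C₃ * C₂ + C₁ * C₄) * (1 / (q ^ 2 * (1 + q ^ 2))) / 4 := by field_simp
    _ ≤ _ := div_le_self (by positivity) (by norm_num)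

/-! ### Fubini at positive regulator and reduction to the real part. -/

lemma integral_tensor_eq_zero {f : Spacetime → ℂ} (h0 : ∫ x, f x = 0) :
    ∫ z : Spacetime × Spacetime, f z.1 * f z.2 = 0 := by
  rw [Measure.volume_eq_prod, integral_prod_mul, h0, zero_mul]

/-- The subtracted inverse Fourier transform of the regularised kernel, up to the factor
`-(π / 2)`. -/
noncomputable def regularizedLog (ε : ℝ) (z : Spacetime × Spacetime) : ℂ :=
  Complex.log (ε + Complex.I * (z.1.1 - z.2.1 : ℝ) - Complex.I * ‖z.1.2 - z.2.2‖) +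
    Complex.log (ε + Complex.I * (z.1.1 - z.2.1 : ℝ) + Complex.I * ‖z.1.2 - z.2.2‖)

lemma continuous_regularizedLog {ε : ℝ} (hε : 0 < ε) : Continuous (regularizedLog ε) := by
  unfold regularizedLog
  refine Continuous.add (Continuous.clog (by fun_prop) fun z => Or.inl ?_)
    (Continuous.clog (by fun_prop) fun z => Or.inl ?_) <;> simpa using hε

/-- The swap reverses `t - t'` and keeps the distance, so each logarithm becomes the conjugate of
the other; `ε > 0` keeps the arguments off the branch cut. -/
lemma regularizedLog_swap {ε : ℝ} (hε : 0 < ε) (z : Spacetime × Spacetime) :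
    regularizedLog ε z.swap = (starRingEnd ℂ) (regularizedLog ε z) := by
  have harg : ∀ v : ℝ, (ε + Complex.I * v : ℂ).arg ≠ Real.pi := by
    intro v h
    have := (Complex.arg_eq_pi_iff.1 h).1
    simp at this
    linarith
  have hm : (ε + Complex.I * (z.1.1 - z.2.1 : ℝ) - Complex.I * ‖z.1.2 - z.2.2‖ : ℂ)
      = ε + Complex.I * ((z.1.1 - z.2.1) - ‖z.1.2 - z.2.2‖ : ℝ) := by push_cast; ring
  have hp : (ε + Complex.I * (z.1.1 - z.2.1 : ℝ) + Complex.I * ‖z.1.2 - z.2.2‖ : ℂ)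
      = ε + Complex.I * ((z.1.1 - z.2.1) + ‖z.1.2 - z.2.2‖ : ℝ) := by push_cast; ring
  unfold regularizedLog
  rw [hm, hp, map_add, ← Complex.log_conj _ (harg _), ← Complex.log_conj _ (harg _), add_comm]
  simp only [Prod.fst_swap, Prod.snd_swap, norm_sub_rev z.2.2, map_add, map_mul,
    Complex.conj_ofReal, Complex.conj_I]
  congr 2 <;> push_cast <;> ring

lemma log_norm_add_I_mul (ε v : ℝ) :
    (Complex.log (ε + Complex.I * v)).re = 1 / 2 * Real.log (ε ^ 2 + v ^ 2) := by
  rw [Complex.log_re, mul_comm, Complex.norm_add_mul_I, Real.log_sqrt (by positivity)]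
  ring

lemma regularizedLog_re (ε : ℝ) (z : Spacetime × Spacetime) :
    (regularizedLog ε z).re
      = 1 / 2 * Real.log (ε ^ 2 + (z.1.1 - z.2.1 - ‖z.1.2 - z.2.2‖) ^ 2) +
        1 / 2 * Real.log (ε ^ 2 + (z.1.1 - z.2.1 + ‖z.1.2 - z.2.2‖) ^ 2) := by
  rw [← log_norm_add_I_mul, ← log_norm_add_I_mul, regularizedLog, Complex.add_re]
  congr 3 <;> push_cast <;> ring

/-- The weight `f x * f x'` is symmetric, even for complex `f`, while the imaginary part is
antisymmetric. -/
lemma integral_tensor_mul_regularizedLog {f : Spacetime → ℂ} (hf : Continuous f)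
    (hs : HasCompactSupport f) {ε : ℝ} (hε : 0 < ε) :
    ∫ z : Spacetime × Spacetime, f z.1 * f z.2 * regularizedLog ε z
      = ∫ z : Spacetime × Spacetime, f z.1 * f z.2 * ((regularizedLog ε z).re : ℂ) := by
  have hc := continuous_regularizedLog hε
  have hi : Integrable fun z : Spacetime × Spacetime => f z.1 * f z.2 * regularizedLog ε z :=
    Continuous.integrable_of_hasCompactSupport (by fun_prop) (hasCompactSupport_tensor hs id rfl _)
  have hcc : Continuous fun z => (starRingEnd ℂ) (regularizedLog ε z) :=
    Complex.continuous_conj.comp hc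
  have hi' : Integrable fun z : Spacetime × Spacetime =>
      f z.1 * f z.2 * (starRingEnd ℂ) (regularizedLog ε z) :=
    Continuous.integrable_of_hasCompactSupport (by fun_prop) (hasCompactSupport_tensor hs id rfl _)
  have hswap : ∫ z : Spacetime × Spacetime, f z.1 * f z.2 * regularizedLog ε z
      = ∫ z : Spacetime × Spacetime, f z.1 * f z.2 * (starRingEnd ℂ) (regularizedLog ε z) := by
    rw [Measure.volume_eq_prod, ← integral_prod_swap]
    refine integral_congr_ae (Eventually.of_forall fun z => ?_)
    simp only [regularizedLog_swap hε, Prod.fst_swap, Prod.snd_swap]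
    ring
  have hadd := integral_add hi hi'
  rw [← hswap, ← two_mul] at hadd
  have h2 : (∫ z : Spacetime × Spacetime, f z.1 * f z.2 * regularizedLog ε z +
      f z.1 * f z.2 * (starRingEnd ℂ) (regularizedLog ε z))
      = 2 * ∫ z : Spacetime × Spacetime, f z.1 * f z.2 * ((regularizedLog ε z).re : ℂ) := by
    rw [← integral_const_mul]
    refine integral_congr_ae (Eventually.of_forall fun z => ?_)
    simp only [← mul_add, Complex.add_conj]
    push_cast
    ring
  exact mul_left_cancel₀ two_ne_zero (hadd.symm.trans h2)

lemma integral_regularizedSmearing {f : Spacetime → ℂ} (hf : Continuous f)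
    (hs : HasCompactSupport f) (h0 : ∫ x, f x = 0) {ε : ℝ} (hε : 0 < ε) (hε1 : ε ≤ 1) :
    ∫ p, regularizedSmearing f ε p
      = -(Real.pi / 2) *
        ∫ z : Spacetime × Spacetime, f z.1 * f z.2 * ((regularizedLog ε z).re : ℂ) := by
  have hsub : ∀ p, regularizedSmearing f ε p = ∫ z : Spacetime × Spacetime,
      f z.1 * f z.2 * (regularizedKernel ε p z - radialKernel 1 ‖p‖) := by
    intro p
    simp_rw [mul_sub]
    rw [integral_sub, integral_mul_const, integral_tensor_eq_zero h0, zero_mul, sub_zero,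
      regularizedSmearing]
    · exact Continuous.integrable_of_hasCompactSupport (by fun_prop)
        (hasCompactSupport_tensor hs id rfl _)
    · exact Continuous.integrable_of_hasCompactSupport (by fun_prop)
        (hasCompactSupport_tensor hs id rfl _)
  simp_rw [hsub]
  rw [integral_integral_swap]
  · rw [← integral_tensor_mul_regularizedLog hf hs hε, ← integral_const_mul]
    refine integral_congr_ae (Eventually.of_forall fun z => ?_)
    simp only [regularizedKernel]
    rw [integral_const_mul, integral_radialKernel_sub (by simpa using hε), regularizedLog]
    ring
  -- The bound on the subtracted kernel, with `δ = ε`, is a product of a function of `p` and a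
  -- function of `(x, x')`.
  · set w : Spacetime × Spacetime → ℝ := fun z => ‖f z.1 * f z.2‖ *
      (2 * ‖(ε + Complex.I * (z.1.1 - z.2.1 : ℝ) : ℂ)‖ + ‖z.1.2 - z.2.2‖ + 2) with hw
    have hwi : Integrable w :=
      Continuous.integrable_of_hasCompactSupport (by fun_prop)
        (hasCompactSupport_tensor hs norm norm_zero _)
    refine ((integrable_exp_div_sq hε).mul_prod hwi).mono' ?_ (Eventually.of_forall fun y => ?_)
    · refine Measurable.aestronglyMeasurable ?_
      have hfm := hf.measurable
      unfold Function.uncurry regularizedKernel radialKernel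
      fun_prop
    · simp only [Function.uncurry, norm_mul (f _ * f _), hw, regularizedKernel]
      rw [mul_left_comm]
      gcongr
      refine (norm_radialKernel_sub_le ?_ hε1 _ _).trans_eq (mul_comm _ _)
      simp

/-! ### Integrability of the logarithm across the light cone. -/

/-- By translation invariance the shift `c` does not affect the inner integral, so Tonelli leaves a
product. -/
lemma integrable_comp_add_mul {Y : Type*} [MeasureSpace Y] [SFinite (volume : Measure Y)]
    {φ : ℝ → ℝ} (hφ : Integrable φ) (hφm : Measurable φ) {c : Y → ℝ} (hc : Measurable c)
    {g : Y → ℝ} (hg : Integrable g) (hgm : Measurable g) :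
    Integrable fun z : ℝ × Y => φ (z.1 + c z.2) * g z.2 := by
  rw [Measure.volume_eq_prod, integrable_prod_iff' (Measurable.aestronglyMeasurable (by fun_prop))]
  refine ⟨Eventually.of_forall fun y => (hφ.comp_add_right (c y)).mul_const (g y), ?_⟩
  refine (hg.norm.const_mul (∫ t, ‖φ t‖)).congr (Eventually.of_forall fun y => ?_)
  simp only [norm_mul]
  rw [integral_mul_const, integral_add_right_eq_self (fun t => ‖φ t‖)]

lemma ae_add_ne_zero {Y : Type*} [MeasureSpace Y] [SFinite (volume : Measure Y)]
    {c : Y → ℝ} (hc : Measurable c) : ∀ᵐ z : ℝ × Y, z.1 + c z.2 ≠ 0 := by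
  rw [ae_iff, Measure.volume_eq_prod]
  have hm : MeasurableSet {z : ℝ × Y | ¬ z.1 + c z.2 ≠ 0} := by
    simp only [not_not]
    exact measurableSet_eq_fun (by fun_prop) measurable_const
  rw [Measure.prod_apply_symm hm]
  refine (lintegral_congr fun y => ?_).trans lintegral_zero
  have : (fun x : ℝ => (x, y)) ⁻¹' {z : ℝ × Y | ¬ z.1 + c z.2 ≠ 0} = {-c y} := by
    ext x
    simp [add_eq_zero_iff_eq_neg]
  rw [this]
  simp

/-- The light-cone coordinates `t - t' + σ |𝐱 - 𝐱'|` of a pair of spacetime points. -/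
noncomputable def lightConeCoord (σ : ℝ) (z : Spacetime × Spacetime) : ℝ :=
  z.1.1 - z.2.1 + σ * ‖z.1.2 - z.2.2‖

lemma lightConeCoord_eq (σ : ℝ) (z : Spacetime × Spacetime) :
    lightConeCoord σ z = (MeasurableEquiv.prodAssoc z).1 +
      (σ * ‖(MeasurableEquiv.prodAssoc z).2.1 - (MeasurableEquiv.prodAssoc z).2.2.2‖
        - (MeasurableEquiv.prodAssoc z).2.2.1) := by
  simp only [lightConeCoord, MeasurableEquiv.prodAssoc, MeasurableEquiv.coe_mk, Equiv.prodAssoc_apply]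
  ring

lemma ae_lightConeCoord_ne_zero (σ : ℝ) : ∀ᵐ z, lightConeCoord σ z ≠ 0 := by
  have h := (volume_preserving_prodAssoc (α₁ := ℝ) (β₁ := EuclideanSpace ℝ (Fin 3))
    (γ₁ := Spacetime)).quasiMeasurePreserving.ae
    (ae_add_ne_zero (c := fun y : EuclideanSpace ℝ (Fin 3) × Spacetime =>
      σ * ‖y.1 - y.2.2‖ - y.2.1) (by fun_prop))
  filter_upwards [h] with z hz
  rwa [lightConeCoord_eq]

@[fun_prop]
lemma continuous_lightConeCoord (σ : ℝ) : Continuous (lightConeCoord σ) := by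
  unfold lightConeCoord; fun_prop

/-- The light-cone coordinate is `t` plus a function of the other variables, so the singularity is a
locally integrable logarithm in `t` alone. -/
lemma integrable_tensor_mul_abs_log {f : Spacetime → ℂ} (hf : Continuous f)
    (hs : HasCompactSupport f) (σ : ℝ) :
    Integrable fun z : Spacetime × Spacetime =>
      ‖f z.1 * f z.2‖ * |Real.log (lightConeCoord σ z)| := by
  obtain ⟨M, hM⟩ := hf.bounded_above_of_compact_support hs
  have hM0 : 0 ≤ M := (norm_nonneg _).trans (hM 0)
  obtain ⟨R, hR0, hR⟩ := hs.isCompact.isBounded.subset_closedBall_lt 0 (0 : Spacetime)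
  -- On the support `|t - t'|` and the spatial distance are each at most `2 R`.
  set L := 2 * R + |σ| * (2 * R) with hL
  have hL0 : 0 ≤ L := by positivity
  set φ : ℝ → ℝ := (Icc (-L) L).indicator fun u => |Real.log u| with hφ
  set K := Metric.closedBall (0 : EuclideanSpace ℝ (Fin 3)) R ×ˢ
    Metric.closedBall (0 : Spacetime) R with hK
  have hKc : IsCompact K := (isCompact_closedBall _ _).prod (isCompact_closedBall _ _)
  set g : EuclideanSpace ℝ (Fin 3) × Spacetime → ℝ := K.indicator fun _ => M * M with hg
  have hφm : Measurable φ := (by fun_prop : Measurable fun u => |Real.log u|).indicator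
    measurableSet_Icc
  have hφi : Integrable φ := by
    rw [integrable_indicator_iff measurableSet_Icc]
    exact ((intervalIntegrable_iff_integrableOn_Icc_of_le (by linarith)).1
      intervalIntegral.intervalIntegrable_log').abs
  have hgm : Measurable g := measurable_const.indicator hKc.measurableSet
  have hgi : Integrable g :=
    (integrable_indicator_iff hKc.measurableSet).2 (integrableOn_const hKc.measure_ne_top)
  have h := integrable_comp_add_mul hφi hφm (c := fun y : EuclideanSpace ℝ (Fin 3) × Spacetime =>
      σ * ‖y.1 - y.2.2‖ - y.2.1) (by fun_prop) hgi hgm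
  have h' := (volume_preserving_prodAssoc (α₁ := ℝ) (β₁ := EuclideanSpace ℝ (Fin 3))
    (γ₁ := Spacetime)).integrable_comp_of_integrable h
  refine h'.mono' (Measurable.aestronglyMeasurable ?_) (Eventually.of_forall fun z => ?_)
  · have := hf.measurable
    have := (continuous_lightConeCoord σ).measurable
    fun_prop
  · simp only [Function.comp_apply]
    rw [← lightConeCoord_eq, norm_mul, norm_norm, norm_mul, Real.norm_eq_abs, abs_abs]
    have hφ0 : ∀ u, 0 ≤ φ u := fun u => indicator_nonneg (fun _ _ => abs_nonneg _) _
    have hg0 : ∀ y, 0 ≤ g y := fun y => indicator_nonneg (fun _ _ => by positivity) _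
    by_cases h1 : f z.1 = 0
    · simpa [h1] using mul_nonneg (hφ0 _) (hg0 _)
    by_cases h2 : f z.2 = 0
    · simpa [h2] using mul_nonneg (hφ0 _) (hg0 _)
    have b1 : ‖z.1‖ ≤ R := by simpa using hR (subset_tsupport f h1)
    have b2 : ‖z.2‖ ≤ R := by simpa using hR (subset_tsupport f h2)
    have hgz : g (MeasurableEquiv.prodAssoc z).2 = M * M := by
      refine indicator_of_mem ?_ _
      exact ⟨mem_closedBall_zero_iff.2 ((norm_snd_le z.1).trans b1),
        mem_closedBall_zero_iff.2 b2⟩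
    have hv : |lightConeCoord σ z| ≤ L := by
      have t1 := (norm_fst_le z.1).trans b1
      have t2 := (norm_fst_le z.2).trans b2
      have t3 := (norm_snd_le z.1).trans b1
      have t4 := (norm_snd_le z.2).trans b2
      have t5 := norm_sub_le z.1.1 z.2.1
      have t6 := norm_sub_le z.1.2 z.2.2
      refine (abs_add_le _ _).trans ?_
      rw [abs_mul, abs_norm]
      refine add_le_add (t5.trans (by linarith)) ?_
      gcongr
      linarith
    have hφz : φ (lightConeCoord σ z) = |Real.log (lightConeCoord σ z)| :=
      indicator_of_mem (mem_Icc.2 (abs_le.1 hv)) _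
    rw [hgz, hφz, mul_comm]
    gcongr
    · exact hM _
    · exact hM _

/-- The two light-cone coordinates multiply to `-(x - x')²`. Points on the cone are excluded because
`Real.log 0 = 0` would break additivity. -/
lemma log_abs_minkowskiSq {z : Spacetime × Spacetime} (hm : lightConeCoord (-1) z ≠ 0)
    (hp : lightConeCoord 1 z ≠ 0) :
    Real.log |minkowskiSq (z.1 - z.2)|
      = Real.log (lightConeCoord (-1) z) + Real.log (lightConeCoord 1 z) := by
  rw [← Real.log_mul hm hp, Real.log_abs, ← Real.log_neg_eq_log]
  congr 1
  simp only [minkowskiSq, lightConeCoord, Prod.fst_sub, Prod.snd_sub]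
  ring

lemma regularizedLog_re_eq (ε : ℝ) (z : Spacetime × Spacetime) :
    (regularizedLog ε z).re = 1 / 2 * Real.log (ε ^ 2 + lightConeCoord (-1) z ^ 2) +
      1 / 2 * Real.log (ε ^ 2 + lightConeCoord 1 z ^ 2) := by
  rw [regularizedLog_re, lightConeCoord, lightConeCoord]
  simp only [neg_mul, one_mul, sub_eq_add_neg]

/-- From below drop `ε²`; from above use `log u ≤ u - 1` and `ε² ≤ 1`. -/
lemma abs_half_log_add_sq_le {ε v : ℝ} (hε : 0 ≤ ε) (hε1 : ε ≤ 1) (hv : v ≠ 0) :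
    |1 / 2 * Real.log (ε ^ 2 + v ^ 2)| ≤ |Real.log v| + v ^ 2 := by
  have hv2 : 0 < v ^ 2 := by positivity
  have hlow : 2 * Real.log v ≤ Real.log (ε ^ 2 + v ^ 2) := by
    have := Real.log_le_log hv2 (show v ^ 2 ≤ ε ^ 2 + v ^ 2 by nlinarith)
    rwa [Real.log_pow] at this
  have hup : Real.log (ε ^ 2 + v ^ 2) ≤ v ^ 2 := by
    have := Real.log_le_sub_one_of_pos (show 0 < ε ^ 2 + v ^ 2 by positivity)
    nlinarith
  rw [abs_le]
  constructor
  · linarith [neg_abs_le (Real.log v)]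
  · linarith [abs_nonneg (Real.log v)]

lemma tendsto_half_log_add_sq {v : ℝ} (hv : v ≠ 0) :
    Tendsto (fun ε : ℝ => 1 / 2 * Real.log (ε ^ 2 + v ^ 2)) (𝓝[>] 0) (𝓝 (Real.log v)) := by
  have hc : ContinuousAt (fun ε : ℝ => 1 / 2 * Real.log (ε ^ 2 + v ^ 2)) 0 := by
    refine continuousAt_const.mul (ContinuousAt.log (by fun_prop) ?_)
    positivity
  have h := hc.tendsto
  have h0 : 1 / 2 * Real.log (0 ^ 2 + v ^ 2) = Real.log v := by
    rw [zero_pow two_ne_zero, zero_add, Real.log_pow]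
    push_cast
    ring
  rw [h0] at h
  exact h.mono_left nhdsWithin_le_nhds

lemma integrable_tensor_mul_log_minkowskiSq {f : Spacetime → ℂ} (hf : Continuous f)
    (hs : HasCompactSupport f) :
    Integrable fun z : Spacetime × Spacetime =>
      f z.1 * f z.2 * (Real.log |minkowskiSq (z.1 - z.2)| : ℂ) := by
  refine ((integrable_tensor_mul_abs_log hf hs (-1)).add
    (integrable_tensor_mul_abs_log hf hs 1)).mono' ?_ ?_
  · have := hf.measurable
    unfold minkowskiSq
    exact Measurable.aestronglyMeasurable (by fun_prop)
  · filter_upwards [ae_lightConeCoord_ne_zero (-1), ae_lightConeCoord_ne_zero 1] with z hm hp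
    rw [log_abs_minkowskiSq hm hp, norm_mul, Complex.norm_real, Pi.add_apply, ← mul_add]
    gcongr
    exact norm_add_le _ _

/-! ### Removal of the regulator. -/

lemma tendsto_integral_tensor_mul_regularizedLog {f : Spacetime → ℂ} (hf : Continuous f)
    (hs : HasCompactSupport f) :
    Tendsto (fun ε : ℝ =>
        ∫ z : Spacetime × Spacetime, f z.1 * f z.2 * ((regularizedLog ε z).re : ℂ)) (𝓝[>] 0)
      (𝓝 (∫ z : Spacetime × Spacetime,
        f z.1 * f z.2 * (Real.log |minkowskiSq (z.1 - z.2)| : ℂ))) := by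
  have hsq : ∀ σ, Integrable fun z : Spacetime × Spacetime =>
      ‖f z.1 * f z.2‖ * lightConeCoord σ z ^ 2 := fun σ =>
    Continuous.integrable_of_hasCompactSupport (by fun_prop)
      (hasCompactSupport_tensor hs norm norm_zero _)
  refine tendsto_integral_filter_of_dominated_convergence
    (fun z => (‖f z.1 * f z.2‖ * |Real.log (lightConeCoord (-1) z)| +
      ‖f z.1 * f z.2‖ * lightConeCoord (-1) z ^ 2) +
      (‖f z.1 * f z.2‖ * |Real.log (lightConeCoord 1 z)| +
      ‖f z.1 * f z.2‖ * lightConeCoord 1 z ^ 2)) ?_ ?_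
    (((integrable_tensor_mul_abs_log hf hs (-1)).add (hsq _)).add
      ((integrable_tensor_mul_abs_log hf hs 1).add (hsq _))) ?_
  · filter_upwards [self_mem_nhdsWithin] with ε hε
    have hc := Complex.continuous_re.comp (continuous_regularizedLog (mem_Ioi.1 hε))
    simp only [Function.comp_def] at hc
    have hc' := Complex.continuous_ofReal.comp hc
    simp only [Function.comp_def] at hc'
    exact Continuous.aestronglyMeasurable (by fun_prop)
  · filter_upwards [Ioo_mem_nhdsGT (zero_lt_one' ℝ)] with ε hε
    filter_upwards [ae_lightConeCoord_ne_zero (-1), ae_lightConeCoord_ne_zero 1] with z hm hp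
    rw [regularizedLog_re_eq, norm_mul, Complex.norm_real, ← mul_add (‖f z.1 * f z.2‖), ← mul_add (‖f z.1 * f z.2‖),
      ← mul_add (‖f z.1 * f z.2‖)]
    refine mul_le_mul_of_nonneg_left ?_ (norm_nonneg _)
    rw [Real.norm_eq_abs]
    refine (abs_add_le _ _).trans (add_le_add (abs_half_log_add_sq_le hε.1.le hε.2.le hm)
      (abs_half_log_add_sq_le hε.1.le hε.2.le hp))
  · filter_upwards [ae_lightConeCoord_ne_zero (-1), ae_lightConeCoord_ne_zero 1] with z hm hp
    simp only [regularizedLog_re_eq]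
    rw [log_abs_minkowskiSq hm hp]
    exact ((Complex.continuous_ofReal.tendsto _).comp
      ((tendsto_half_log_add_sq hm).add (tendsto_half_log_add_sq hp))).const_mul _

lemma tendsto_integral_regularizedSmearing {f : Spacetime → ℂ} (hf : ContDiff ℝ 1 f)
    (hs : HasCompactSupport f) (h0 : ∫ x, f x = 0) :
    Tendsto (fun ε : ℝ => ∫ p, regularizedSmearing f ε p) (𝓝[>] 0)
      (𝓝 (∫ p, smearedKernel f p)) := by
  obtain ⟨C, hC⟩ := exists_norm_regularizedSmearing_le hf hs h0
  refine tendsto_integral_filter_of_dominated_convergence _ ?_ ?_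
    (integrable_one_div_sq_mul.const_mul C) ?_
  · exact Eventually.of_forall fun ε =>
      (measurable_regularizedSmearing hf.continuous hs ε).aestronglyMeasurable
  · filter_upwards [self_mem_nhdsWithin] with ε hε
    exact Eventually.of_forall (hC ε (mem_Ioi.1 hε).le)
  · refine Eventually.of_forall fun p => ?_
    rw [← regularizedSmearing_zero hf.continuous hs]
    have hc : Continuous fun ε => regularizedSmearing f ε p := by
      -- At fixed `p` the factorised form depends on `ε` only through `exp(-ε‖p‖)` and `1 + ε‖p‖`.
      simp_rw [regularizedSmearing_eq hf.continuous hs]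
      fun_prop
    exact (hc.tendsto 0).mono_left nhdsWithin_le_nhds

lemma integrable_smearedKernel {f : Spacetime → ℂ} (hf : ContDiff ℝ 1 f)
    (hs : HasCompactSupport f) (h0 : ∫ x, f x = 0) : Integrable (smearedKernel f) := by
  obtain ⟨C, hC⟩ := exists_norm_regularizedSmearing_le hf hs h0
  rw [← funext (regularizedSmearing_zero hf.continuous hs)]
  exact (integrable_one_div_sq_mul.const_mul C).mono'
    (measurable_regularizedSmearing hf.continuous hs 0).aestronglyMeasurable
    (Eventually.of_forall (hC 0 le_rfl))

lemma integral_smearedKernel {f : Spacetime → ℂ} (hf : ContDiff ℝ 1 f)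
    (hs : HasCompactSupport f) (h0 : ∫ x, f x = 0) :
    ∫ p, smearedKernel f p = -(Real.pi / 2) * ∫ z : Spacetime × Spacetime,
      f z.1 * f z.2 * (Real.log |minkowskiSq (z.1 - z.2)| : ℂ) := by
  refine tendsto_nhds_unique (tendsto_integral_regularizedSmearing hf hs h0)
    (((tendsto_integral_tensor_mul_regularizedLog hf.continuous hs).const_mul _).congr' ?_)
  filter_upwards [Ioo_mem_nhdsGT (zero_lt_one' ℝ)] with ε hε
  exact (integral_regularizedSmearing hf.continuous hs h0 hε.1 hε.2.le).symm

theorem mainTheorem5 (f : Spacetime → ℂ)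
    (hf_smooth : ContDiff ℝ ((⊤ : ℕ∞) : WithTop ℕ∞) f)
    (hf_supp : HasCompactSupport f)
    (hf_mean : ∫ x : Spacetime, f x = 0) :
    MeasureTheory.Integrable
        (fun p : EuclideanSpace ℝ (Fin 3) => smearedKernel f p / (2 * (Real.pi : ℂ)) ^ 3) ∧
      MeasureTheory.Integrable
        (fun z : Spacetime × Spacetime =>
          f z.1 * f z.2 * (Real.log |minkowskiSq (z.1 - z.2)| : ℂ)) ∧
      ∫ p : EuclideanSpace ℝ (Fin 3), smearedKernel f p / (2 * (Real.pi : ℂ)) ^ 3 =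
        -(1 / (16 * (Real.pi : ℂ) ^ 2)) *
          ∫ x : Spacetime, ∫ x' : Spacetime,
            f x * f x' * (Real.log |minkowskiSq (x - x')| : ℂ) := by
  have hf : ContDiff ℝ 1 f := hf_smooth.of_le (by exact_mod_cast le_top)
  have hlog := integrable_tensor_mul_log_minkowskiSq hf.continuous hf_supp
  refine ⟨(integrable_smearedKernel hf hf_supp hf_mean).div_const _, hlog, ?_⟩
  rw [integral_div, integral_smearedKernel hf hf_supp hf_mean, Measure.volume_eq_prod,
    integral_prod _ hlog]
  have hpi : (Real.pi : ℂ) ≠ 0 := by exact_mod_cast Real.pi_ne_zero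
  -- The constant is `(π/2) / (2π)³ = 1 / (16 π²)`.
  field_simp
  ring
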